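/- Theorem 7.5. Let $d \ge 3$ and $\mathbb I=[0,1]$. A $d$-dimensional copula $C$ is the restriction to $\mathbb I^d$ of the distribution function of a probability measure $\mu_C$ on $\mathbb I^d$ with uniform univariate marginals; $C_J$ is the marginal copula of the coordinates in $J$, $\Pi$ is the independence copula, and $d_\infty(C_1,C_2)=\max_{\mathbf u\in\mathbb I^d}|C_1(\mathbf u)-C_2(\mathbf u)|$. For $L\subseteq\{1,\dots,d\}$ and $j\notin L$ let $F_{j|L}(\cdot|\mathbf t)$ be the conditional distribution function under $\mu_C$ of the $j$-th coordinate given that the coordinates in $L$ equal $\mathbf t$. Let $\mathcal C^d_{\rm c}$ be the class of all $d$-dimensional copulas such that, whenever $1\le|L|\le d-2$ and $j\notin L$, $F_{j|L}(\cdot|\mathbf t)$ is continuous for $\mu_{C_L}$-almost every $\mathbf t$. For $C\in\mathcal C^d_{\rm c}$ and $\mu_{C_L}$-almost every $\mathbf t$, let $C^{\mathbf t}_{i,j;L}$ denote the bivariate copula of the conditional distribution of the coordinates $i,j$ given that the coordinates in $L$ equal $\mathbf t$; it is unique by Sklar's theorem. The partial D-vine copula $\psi(C)=C^{\rm PVC}$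 is built from its marginals on consecutive coordinates: $(C^{\rm PVC})_{i,i+1}:=C_{i,i+1}$ and, for $j-i=2,3,\dots,d-1$ in turn, with $L=\{i+1,\dots,j-1\}$, $$(C_p)_{i,j}(s,t):=\int C^{\mathbf w}_{i,j;L}(s,t)\,\mathrm d\mu_{(C^{\rm PVC})_L}(\mathbf w),$$ $$(C^{\rm PVC})_{i,\dots,j}(\mathbf u):=\int_{[\mathbf 0,\mathbf u_L]}(C_p)_{i,j}\big(F^{\rm PVC}_{i|L}(u_i|\mathbf t),F^{\rm PVC}_{j|L}(u_j|\mathbf t)\big)\,\mathrm d\mu_{(C^{\rm PVC})_L}(\mathbf t),$$ where the conditional distribution functions $F^{\rm PVC}$ are those of the marginals of $C^{\rm PVC}$ from the previous step. (If the outcome is not unique, because it depends on how the conditional copulas $C^{\mathbf w}_{i,j;L}$ are chosen, measurably in $\mathbf w$, on $\mu_{C_L}$-null sets, put $\psi(C):=C$; such $C$ contribute $0$ to the supremum below.) Let $C^{\rm Cube}$ be the three-dimensional copula whose mass is uniformly distributed on the four cubes $(0,\frac12)\times(0,\frac12)\times(0,\frac12)$, $(\frac12,1)\times(\frac12,1)\times(0,\frac12)$,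 $(0,\frac12)\times(\frac12,1)\times(\frac12,1)$ and $(\frac12,1)\times(0,\frac12)\times(\frac12,1)$, and let $C$ be the $d$-dimensional copula $C(\mathbf u,\mathbf v):=C^{\rm Cube}(\mathbf u)\,\Pi(\mathbf v)=C^{\rm Cube}(\mathbf u)\prod_k v_k$ for $(\mathbf u,\mathbf v)\in\mathbb I^3\times\mathbb I^{d-3}$. Then $C^{\rm Cube}$ and $C$ exist, $C\in\mathcal C^d_{\rm c}$, the construction above has exactly one outcome for $C$, namely $\psi(C)=\Pi$, and $$d_\infty(C,\psi(C))\ \ge\ \tfrac18 .$$ In particular, for every $d\ge3$ some copula $C\in\mathcal C^d_{\rm c}$ satisfies $d_\infty(C,\psi(C))\ge\frac18$, and $$\frac18\ \le\ \sup_{C\in\mathcal C^d_{\rm c}} d_\infty\big(C,\psi(C)\big)<\infty .$$ -/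

import Mathlib

open MeasureTheory ProbabilityTheory

noncomputable section

/-- A copula with coordinates indexed by `ι`, given through its `d`-stochastic measure: a
probability measure on the cube `[0,1]^ι` all of whose univariate marginals are the Lebesgue
measure on `[0,1]`. The copula as a function is the distribution function of this measure. -/
structure Copula (ι : Type) where
  /-- the `d`-stochastic measure `μ_C` -/
  measure : Measure (ι → unitInterval)
  isProbabilityMeasure : IsProbabilityMeasure measure
  map_eval : ∀ i, measure.map (fun x => x i) = (volume : Measure unitInterval)

namespace Copula

variable {ι : Type}

instance (C : Copula ι) : IsProbabilityMeasure C.measure := C.isProbabilityMeasure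

/-- `C(u) = μ_C([0,u])`. -/
instance : CoeFun (Copula ι) (fun _ => (ι → unitInterval) → ℝ) :=
  ⟨fun C u => C.measure.real (Set.Iic u)⟩

/-- The independence copula `Π`. -/
def indep (ι : Type) [Fintype ι] : Copula ι where
  measure := volume
  isProbabilityMeasure := inferInstance
  map_eval i := (measurePreserving_eval (fun _ => volume) i).map_eq

/-- The marginal copula `C_J` with respect to the coordinates in `J`. -/
def marginal (C : Copula ι) (J : Finset ι) : Copula J where
  measure := C.measure.map J.restrict
  isProbabilityMeasure :=
    Measure.isProbabilityMeasure_map (Finset.measurable_restrict J).aemeasurable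
  map_eval i := by
    have h := Measure.map_map (μ := C.measure) (measurable_pi_apply i)
      (Finset.measurable_restrict J)
    exact h.trans (C.map_eval i)

/-- The uniform metric `d_∞`. -/
def dInf (C₁ C₂ : Copula ι) : ℝ := ⨆ u : ι → unitInterval, |C₁ u - C₂ u|

section Conditioning

variable [Countable ι]

/-- The conditional univariate distribution function `F_{j|L}(u|t)` of the `j`-th coordinate given
that the coordinates in `L` have the values `t`, from a regular conditional distribution. -/
def condDF (C : Copula ι) (L : Finset ι) (j : ι) (t : L → unitInterval) (u : unitInterval) :
    unitInterval :=
  ⟨(condDistrib (fun x : ι → unitInterval => x j) L.restrict C.measure t).real (Set.Iic u),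
    measureReal_nonneg, measureReal_le_one⟩

/-- `A` is a (measurable) family of conditional copulas `C^t_{ij;L}` of the coordinates `i, j`
given the coordinates in `L`: for `μ_{C_L}`-almost every `t`,
`K_C(t, [0,u] × [0,v]) = A^t (F_{i|L}(u|t), F_{j|L}(v|t))` for all `u, v`,
where `K_C` is the Markov kernel (regular conditional distribution) of the coordinates `i, j` given
those in `L`. -/
def IsCondCopula (C : Copula ι) (i j : ι) (L : Finset ι)
    (A : (L → unitInterval) → Copula (Fin 2)) : Prop :=
  (∀ s : Fin 2 → unitInterval, Measurable fun t => A t s) ∧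
  ∀ᵐ t ∂(C.marginal L).measure, ∀ u v : unitInterval,
    (condDistrib (fun x : ι → unitInterval => (x i, x j)) L.restrict C.measure t).real
        (Set.Iic u ×ˢ Set.Iic v) =
      A t ![C.condDF L i t u, C.condDF L j t v]

end Conditioning

/-- The class `C^d_c` of copulas with continuous conditional univariate distribution functions:
for all `L` with `1 ≤ |L| ≤ d - 2` and all `j ∉ L`, the function `F_{j|L}(·|t)` is
continuous for `μ_{C_L}`-almost every `t`. -/
def classC (ι : Type) [Fintype ι] : Set (Copula ι) :=
  {C | ∀ L : Finset ι, 1 ≤ L.card → L.card + 2 ≤ Fintype.card ι → ∀ j ∉ L,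
    ∀ᵐ t ∂(C.marginal L).measure, Continuous (C.condDF L j t)}

section DVine

variable {d : ℕ}

/-- `D` results from `C` by the construction of the partial vine copula of D-vine structure.

* `D_{i,i+1} = C_{i,i+1}`.
* For `i + 2 ≤ j`, with `L = {i+1, …, j-1}`: there is a family `A` of conditional copulas of `C` of
  the coordinates `i, j` given `L`, and the partial copula `P = ∫ A^w dμ_{D_L}(w)`, such that
  `D_{i,…,j}(u) = ∫_{[0,u_L]} P (F_{i|L}(u_i|t), F_{j|L}(u_j|t)) dμ_{D_L}(t)`,
  the conditional distribution functions `F` being those of `D`.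

The measure `μ_{D_L}` and the functions `F` depend only on the marginals of `D` of the
previous steps, so the conditions build the marginals `D_{i,…,j}` one after the other, by
increasing `j - i`. -/
def IsPartialDVine (C D : Copula (Fin d)) : Prop :=
  (∀ i j : Fin d, (i : ℕ) + 1 = j → D.marginal {i, j} = C.marginal {i, j}) ∧
  ∀ i j : Fin d, (i : ℕ) + 2 ≤ j →
    ∃ (A : (Finset.Ioo i j → unitInterval) → Copula (Fin 2)) (P : Copula (Fin 2)),
      C.IsCondCopula i j (Finset.Ioo i j) A ∧
      (∀ s : Fin 2 → unitInterval, P s = ∫ w, A w s ∂(D.marginal (Finset.Ioo i j)).measure) ∧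
      ∀ u : Fin d → unitInterval,
        D.marginal (Finset.Icc i j) ((Finset.Icc i j).restrict u) =
          ∫ t in Set.Iic ((Finset.Ioo i j).restrict u),
            P ![D.condDF (Finset.Ioo i j) i t (u i), D.condDF (Finset.Ioo i j) j t (u j)]
            ∂(D.marginal (Finset.Ioo i j)).measure

open scoped Classical in
/-- The map `ψ`: `ψ(C)` is the copula that results from `C` by the D-vine construction. Where
the outcome of the construction is not unique (for `d ≥ 5` it may depend on the
conditional copulas on a `μ_{C_L}`-null set), the value is set to `C`. -/
def partialDVine (C : Copula (Fin d)) : Copula (Fin d) :=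
  if h : ∃! D, IsPartialDVine C D then h.choose else C

end DVine

/-- The union of the four open cubes which carry the mass of `C^Cube`. -/
def cubeSet : Set (Fin 3 → unitInterval) :=
  {x | ((x 0 : ℝ) ∈ Set.Ioo 0 (1 / 2) ∧ (x 1 : ℝ) ∈ Set.Ioo 0 (1 / 2) ∧
        (x 2 : ℝ) ∈ Set.Ioo 0 (1 / 2)) ∨
       ((x 0 : ℝ) ∈ Set.Ioo (1 / 2) 1 ∧ (x 1 : ℝ) ∈ Set.Ioo (1 / 2) 1 ∧
        (x 2 : ℝ) ∈ Set.Ioo 0 (1 / 2)) ∨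
       ((x 0 : ℝ) ∈ Set.Ioo 0 (1 / 2) ∧ (x 1 : ℝ) ∈ Set.Ioo (1 / 2) 1 ∧
        (x 2 : ℝ) ∈ Set.Ioo (1 / 2) 1) ∨
       ((x 0 : ℝ) ∈ Set.Ioo (1 / 2) 1 ∧ (x 1 : ℝ) ∈ Set.Ioo 0 (1 / 2) ∧
        (x 2 : ℝ) ∈ Set.Ioo (1 / 2) 1)}

/-- `Q` is the copula `C^Cube`: its measure is the uniform distribution on `cubeSet`. -/
def IsCube (Q : Copula (Fin 3)) : Prop :=
  Q.measure = (volume : Measure (Fin 3 → unitInterval))[|cubeSet]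

/-- `C = Q ⊗ Π`, i.e. `C(u,v) = Q(u) Π(v)` for `u` in `[0,1]^3` and `v` in `[0,1]^(d-3)`. -/
def IsProdIndep {d : ℕ} (hd : 3 ≤ d) (Q : Copula (Fin 3)) (C : Copula (Fin d)) : Prop :=
  ∀ u : Fin d → unitInterval,
    C u = Q (fun k => u (Fin.castLE hd k)) *
      ∏ i ∈ Finset.univ.filter (fun i : Fin d => 3 ≤ (i : ℕ)), (u i : ℝ)

end Copula

end

noncomputable section

namespace Copula

/-! The four cubes are the octants in which an even number of coordinates exceed 1/2. Reflecting any
one of the first three coordinates at 1/2 changes this parity, so it exchanges the support with its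
complement up to a null set. Hence every marginal that omits one of these three coordinates is
Lebesgue measure (`unifOn_cubeProd`): the dependence is purely three-way. The D-vine construction
does not see it. Neighbouring pairs are independent. For the coordinates 0 and 2 given 1, the
conditional margins are uniform, so averaging the conditional copulas returns the law of the pair
(0,2), which is independence (`IsCondCopula.integral_eq`). A coordinate of index at least 3 is
independent of all others, so its conditional copulas with earlier coordinates are almost surely Π
(`IsCondCopula.ae_eq_indep`). Both facts hold for every choice of conditional copulas; induction on
interval length (`IsPartialDVine.eq_indep`) then makes Π the only outcome. At the point with first
three coordinates 1/2 and all others 1, the values are 1/4 and 1/8. -/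

/-! ### Lebesgue measure on the cube and conditional distribution functions -/

lemma eq_volume_of_Iic {ι : Type*} [Fintype ι] {μ : Measure (ι → unitInterval)}
    (h : ∀ u, μ (Set.Iic u) = ∏ i, ENNReal.ofReal (u i)) : μ = volume := by
  refine (Measure.pi_eq_generateFrom (C := fun _ => Set.range Set.Iic)
    (fun _ => (borel_eq_generateFrom_Iic unitInterval).symm.trans
      (BorelSpace.measurable_eq (α := unitInterval)).symm)
    -- Since `[0,1]` has a top element, the whole space is itself a lower set, so a constant
    -- sequence spans.
    (fun _ => isPiSystem_Iic) (fun _ => ⟨fun _ => Set.univ, fun _ => ⟨⊤, Set.Iic_top⟩,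
      fun _ => measure_lt_top _ _, Set.iUnion_const _⟩) fun s hs => ?_).symm
  choose u hu using hs
  obtain rfl : (fun i => Set.Iic (u i)) = s := funext hu
  rw [Set.pi_univ_Iic, h]
  simp [unitInterval.volume_Iic]

lemma volume_pi_Iic {ι : Type*} [Fintype ι] (u : ι → unitInterval) :
    (volume : Measure (ι → unitInterval)) (Set.Iic u) = ∏ i, ENNReal.ofReal (u i) := by
  rw [← Set.pi_univ_Iic, volume_pi_pi]
  simp [unitInterval.volume_Iic]

lemma volume_real_pi_Iic {ι : Type*} [Fintype ι] (u : ι → unitInterval) :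
    (volume : Measure (ι → unitInterval)).real (Set.Iic u) = ∏ i, (u i : ℝ) := by
  rw [measureReal_def, volume_pi_Iic, ENNReal.toReal_prod]
  exact Finset.prod_congr rfl fun i _ => ENNReal.toReal_ofReal (u i).2.1

lemma indep_apply {ι : Type} [Fintype ι] (u : ι → unitInterval) :
    (indep ι).measure.real (Set.Iic u) = ∏ i, (u i : ℝ) := volume_real_pi_Iic u

lemma measure_injective {ι : Type} : Function.Injective (measure : Copula ι → _) := by
  rintro ⟨μ, _, _⟩ ⟨ν, _, _⟩ rfl
  rfl

/-- A function depending on the coordinates in `J` only factors measurably through `J.restrict`. -/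
lemma exists_measurable_factor {ι : Type*} {β : Type*} [MeasurableSpace β] {g : (ι → unitInterval) → β}
    (hg : Measurable g) {J : Finset ι} (h : DependsOn g (J : Set ι)) :
    ∃ g' : (J → unitInterval) → β, Measurable g' ∧ g = g' ∘ J.restrict := by
  classical
  refine ⟨fun y => g fun i => if hi : i ∈ J then y ⟨i, hi⟩ else 0, hg.comp ?_, ?_⟩
  · refine measurable_pi_lambda _ fun i => ?_
    by_cases hi : i ∈ J
    · simp [hi]; fun_prop
    · simp [hi]
  · ext1 x
    refine h fun i hi => ?_
    simp only [Finset.mem_coe] at hi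
    simp [hi]

lemma dependsOn_restrict {ι : Type*} {J K : Finset ι} (h : J ⊆ K) :
    DependsOn (J.restrict : (ι → unitInterval) → _) (K : Set ι) :=
  fun _ _ hxy => funext fun i => hxy i (h i.2)

lemma indepFun_restrict_eval {ι : Type} {C : Copula ι} {S : Finset ι} {i : ι}
    (h : IndepFun S.restrict ({i} : Finset ι).restrict C.measure) :
    IndepFun S.restrict (fun x => x i) C.measure :=
  h.comp (φ := id) (ψ := fun y : ({i} : Finset ι) → unitInterval => y ⟨i, by simp⟩)
    measurable_id (measurable_pi_apply _)

/-- Absolute continuity excludes atoms: as `v → u`, the indicators of `Set.Iic v` converge at every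
point other than `u`, and dominated convergence applies. -/
lemma continuous_condDF {ι : Type} {C : Copula ι} {L : Finset ι} {j : ι} {t : L → unitInterval}
    (h : condDistrib (fun x : ι → unitInterval => x j) L.restrict C.measure t ≪ volume) :
    Continuous (C.condDF L j t) := by
  refine Continuous.subtype_mk (continuous_iff_continuousAt.2 fun u => ?_) _
  refine (ENNReal.tendsto_toReal (measure_ne_top _ _)).comp
    (tendsto_measure_of_ae_tendsto_indicator_of_isFiniteMeasure _ measurableSet_Iic
      (fun _ => measurableSet_Iic) ?_)
  have hu : ∀ᵐ x ∂(volume : Measure unitInterval), x ≠ u := by simp [ae_iff]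
  filter_upwards [h.ae_le hu] with x hx
  rcases lt_or_gt_of_ne hx with hx | hx
  · filter_upwards [lt_mem_nhds hx] with v hv
    simp [hx.le, hv.le]
  · filter_upwards [gt_mem_nhds hx] with v hv
    simp [not_le.2 hx, not_le.2 hv]

/-- Intermediate values between 0 and 1. Surjectivity is what lets the Sklar identity determine a
conditional copula on the whole square. -/
lemma condDF_surjective {ι : Type} {C : Copula ι} {L : Finset ι} {j : ι} {t : L → unitInterval}
    (h : condDistrib (fun x : ι → unitInterval => x j) L.restrict C.measure t ≪ volume) :
    Function.Surjective (C.condDF L j t) := by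
  intro u
  have h0 : C.condDF L j t 0 = 0 := by
    refine Subtype.ext ?_
    have : (volume : Measure unitInterval) (Set.Iic 0) = 0 := by simp [unitInterval.volume_Iic]
    simp [condDF, measureReal_def, h this]
  have h1 : C.condDF L j t 1 = 1 := by
    refine Subtype.ext ?_
    have : Set.Iic (1 : unitInterval) = Set.univ := Set.Iic_top
    simp [condDF, this]
  have := intermediate_value_univ 0 1 (continuous_condDF h)
  rw [h0, h1] at this
  exact this ⟨u.2.1, u.2.2⟩

/-! ### Copulas with uniform marginals on a set of coordinates -/

section

variable {ι : Type} [Fintype ι]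

/-- The marginal of `C` on the coordinates in `J` is the independence copula. -/
def UnifOn (C : Copula ι) (J : Finset ι) : Prop :=
  C.measure.map J.restrict = (volume : Measure (ι → unitInterval)).map J.restrict

lemma volume_map_precomp {ι κ : Type*} [Fintype ι] [Fintype κ] {e : κ → ι}
    (he : Function.Injective e) :
    (volume : Measure (ι → unitInterval)).map (fun x k => x (e k)) = volume := by
  have h : iIndepFun (fun k (x : ι → unitInterval) => x (e k)) volume := (iIndepFun_pi (μ := fun _ : ι => (volume : Measure unitInterval))
    (X := fun _ => id) fun _ => aemeasurable_id).precomp he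
  rw [iIndepFun_iff_map_fun_eq_pi_map fun k => (measurable_pi_apply (e k)).aemeasurable] at h
  refine h.trans ?_
  rw [volume_pi]
  congr 1
  ext1 k
  exact (measurePreserving_eval (fun _ : ι => (volume : Measure unitInterval)) (e k)).map_eq

lemma volume_map_restrict (J : Finset ι) :
    (volume : Measure (ι → unitInterval)).map J.restrict = volume :=
  volume_map_precomp Subtype.val_injective

/-- The transfer principle: laws of functions of the coordinates in `J` may be computed under
Lebesgue measure. -/
lemma UnifOn.map_eq {C : Copula ι} {J : Finset ι} (hC : C.UnifOn J) {β : Type*}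
    [MeasurableSpace β] {g : (ι → unitInterval) → β}
    (hg : Measurable g) (h : DependsOn g (J : Set ι)) :
    C.measure.map g = (volume : Measure (ι → unitInterval)).map g := by
  obtain ⟨g', hg', rfl⟩ := exists_measurable_factor hg h
  rw [← Measure.map_map hg' (Finset.measurable_restrict J), hC,
    Measure.map_map hg' (Finset.measurable_restrict J)]

lemma UnifOn.mono {C : Copula ι} {J K : Finset ι} (hC : C.UnifOn K) (h : J ⊆ K) : C.UnifOn J :=
  hC.map_eq (Finset.measurable_restrict J) (dependsOn_restrict h)

lemma UnifOn.marginal_measure {C : Copula ι} {J : Finset ι} (hC : C.UnifOn J) :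
    (C.marginal J).measure = volume :=
  hC.trans (volume_map_restrict J)

lemma unifOn_iff_marginal_eq {C : Copula ι} {J : Finset ι} :
    C.UnifOn J ↔ (C.marginal J).measure = volume := by
  rw [UnifOn, volume_map_restrict]
  rfl

lemma unifOn_indep (J : Finset ι) : (indep ι).UnifOn J := rfl

lemma UnifOn.eq_indep {C : Copula ι} (hC : C.UnifOn Finset.univ) : C = indep ι := by
  refine measure_injective ?_
  simpa [indep] using hC.map_eq measurable_id fun x y h => funext fun i => h i (by simp)

lemma indepFun_restrict_volume {S T : Finset ι} (h : Disjoint S T) :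
    IndepFun S.restrict T.restrict (volume : Measure (ι → unitInterval)) :=
  (iIndepFun_pi (μ := fun _ : ι => (volume : Measure unitInterval))
    (X := fun _ => id) fun _ => aemeasurable_id).indepFun_finset S T h fun _ => by fun_prop

lemma UnifOn.indepFun [DecidableEq ι] {C : Copula ι} {S T : Finset ι} (hC : C.UnifOn (S ∪ T)) (h : Disjoint S T) :
    IndepFun S.restrict T.restrict C.measure := by
  have hv := indepFun_restrict_volume h
  have hS := Finset.measurable_restrict (X := fun _ : ι => unitInterval) S
  have hT := Finset.measurable_restrict (X := fun _ : ι => unitInterval) T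
  rw [indepFun_iff_map_prod_eq_prod_map_map hS.aemeasurable hT.aemeasurable] at hv ⊢
  rw [hC.map_eq hS (dependsOn_restrict Finset.subset_union_left),
    hC.map_eq hT (dependsOn_restrict Finset.subset_union_right), ← hv]
  refine hC.map_eq (hS.prodMk hT) fun x y hxy => Prod.ext ?_ ?_
  · exact dependsOn_restrict Finset.subset_union_left hxy
  · exact dependsOn_restrict Finset.subset_union_right hxy

/-- The joint law is a product, so the constant kernel is a version of the conditional distribution,
and versions agree almost everywhere. -/
lemma condDistrib_of_indepFun {C : Copula ι} {L : Finset ι} {j : ι}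
    (h : IndepFun L.restrict (fun x => x j) C.measure) :
    ∀ᵐ t ∂(C.marginal L).measure,
      condDistrib (fun x : ι → unitInterval => x j) L.restrict C.measure t = volume := by
  rw [indepFun_iff_map_prod_eq_prod_map_map (Finset.measurable_restrict L).aemeasurable
    (measurable_pi_apply j).aemeasurable, ← Measure.compProd_const] at h
  filter_upwards [condDistrib_ae_eq_of_measure_eq_compProd L.restrict
    (measurable_pi_apply j).aemeasurable h] with t ht
  rw [ht, Kernel.const_apply, C.map_eval j]

lemma condDF_of_indepFun {C : Copula ι} {L : Finset ι} {j : ι}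
    (h : IndepFun L.restrict (fun x => x j) C.measure) :
    ∀ᵐ t ∂(C.marginal L).measure, ∀ u, C.condDF L j t u = u := by
  filter_upwards [condDistrib_of_indepFun h] with t ht u
  refine Subtype.ext ?_
  simp only [condDF, ht, measureReal_def, unitInterval.volume_Iic, ENNReal.toReal_ofReal u.2.1]

lemma UnifOn.indepFun_eval [DecidableEq ι] {C : Copula ι} {L : Finset ι} {j : ι}
    (hC : C.UnifOn (insert j L)) (hj : j ∉ L) :
    IndepFun L.restrict (fun x => x j) C.measure := by
  refine indepFun_restrict_eval (UnifOn.indepFun ?_ ?_)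
  · rwa [Finset.union_comm, ← Finset.insert_eq]
  · simpa using hj

/-- If `μ_C` is absolutely continuous, so are almost all conditional distributions. -/
lemma condDistrib_absolutelyContinuous {C : Copula ι} (hC : C.measure ≪ volume)
    {L : Finset ι} {j : ι} (hj : j ∉ L) :
    ∀ᵐ t ∂(C.marginal L).measure,
      condDistrib (fun x : ι → unitInterval => x j) L.restrict C.measure t ≪ volume := by
  have hL := Finset.measurable_restrict (X := fun _ : ι => unitInterval) L
  have hv : IndepFun L.restrict (fun x => x j) (indep ι).measure :=
    indepFun_restrict_eval (indepFun_restrict_volume (by simpa using hj))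
  rw [indepFun_iff_map_prod_eq_prod_map_map hL.aemeasurable (measurable_pi_apply j).aemeasurable,
    (indep ι).map_eval j, ← Measure.compProd_const] at hv
  -- Under Lebesgue measure the joint law disintegrates with the constant uniform kernel; absolute
  -- continuity of joint laws passes to almost all kernels.
  have h : C.measure.map (fun x => (L.restrict x, x j)) ≪
      (indep ι).measure.map (fun x => (L.restrict x, x j)) :=
    Measure.AbsolutelyContinuous.map hC (hL.prodMk (measurable_pi_apply j))
  rw [hv, ← compProd_map_condDistrib (measurable_pi_apply j).aemeasurable] at h
  filter_upwards [h.kernel_of_compProd] with t ht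
  simpa using ht

end

/-! ### The four cubes and reflections -/

lemma measurableSet_cubeSet : MeasurableSet cubeSet := by
  have h (k : Fin 3) (a b : ℝ) :
      MeasurableSet {x : Fin 3 → unitInterval | (x k : ℝ) ∈ Set.Ioo a b} :=
    (measurable_subtype_coe.comp (measurable_pi_apply k)) measurableSet_Ioo
  exact (((h _ _ _).inter ((h _ _ _).inter (h _ _ _))).union
    (((h _ _ _).inter ((h _ _ _).inter (h _ _ _))).union
    (((h _ _ _).inter ((h _ _ _).inter (h _ _ _))).union
    ((h _ _ _).inter ((h _ _ _).inter (h _ _ _))))))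

/-- Reflection of the coordinate `k` at `1 / 2`. -/
def reflect {ι : Type*} [DecidableEq ι] (k : ι) (x : ι → unitInterval) : ι → unitInterval :=
  fun i => if i = k then unitInterval.symm (x i) else x i

lemma measurePreserving_reflect {ι : Type*} [Fintype ι] [DecidableEq ι] (k : ι) :
    MeasurePreserving (reflect k : (ι → unitInterval) → _) := by
  have := volume_preserving_pi (ι := ι) (α' := fun _ => unitInterval) (β' := fun _ => unitInterval)
    (f := fun i y => if i = k then unitInterval.symm y else y) fun i => by
      by_cases h : i = k
      · simpa [h] using unitInterval.measurePreserving_symm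
      · simp only [h, if_false]
        exact MeasurePreserving.id _
  exact this

lemma ae_forall_ne {ι : Type*} [Fintype ι] (c : unitInterval) :
    ∀ᵐ x : ι → unitInterval, ∀ i, x i ≠ c := by
  have hc : ∀ᵐ y : unitInterval, y ≠ c := by simp [ae_iff]
  exact ae_all_iff.2 fun i => (Measure.quasiMeasurePreserving_eval
    (fun _ : ι => (volume : Measure unitInterval)) i).ae (p := fun y => y ≠ c) hc

/-- Off the faces and midplanes each coordinate lies in exactly one open half, and membership means
that the number of upper halves is even. A reflection changes that parity; the eight octants are
checked in turn. -/
lemma reflect_mem_cubeSet {y : Fin 3 → unitInterval}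
    (hy : ∀ i, (y i : ℝ) ≠ 0 ∧ (y i : ℝ) ≠ 1 / 2 ∧ (y i : ℝ) ≠ 1) (k : Fin 3) :
    reflect k y ∈ cubeSet ↔ y ∉ cubeSet := by
  have h (i : Fin 3) : ((y i : ℝ) ∈ Set.Ioo 0 (1 / 2) ∧ (y i : ℝ) ∉ Set.Ioo (1 / 2) 1 ∧
        1 - (y i : ℝ) ∈ Set.Ioo (1 / 2) 1 ∧ 1 - (y i : ℝ) ∉ Set.Ioo 0 (1 / 2)) ∨
      ((y i : ℝ) ∉ Set.Ioo 0 (1 / 2) ∧ (y i : ℝ) ∈ Set.Ioo (1 / 2) 1 ∧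
        1 - (y i : ℝ) ∉ Set.Ioo (1 / 2) 1 ∧ 1 - (y i : ℝ) ∈ Set.Ioo 0 (1 / 2)) := by
    obtain ⟨h0, h2, h1⟩ := hy i
    have h0' := lt_of_le_of_ne (y i).2.1 h0.symm
    have h1' := lt_of_le_of_ne (y i).2.2 h1
    simp only [Set.mem_Ioo]
    rcases lt_or_gt_of_ne h2 with h | h
    · left
      refine ⟨⟨?_, ?_⟩, fun h => ?_, ⟨?_, ?_⟩, fun h => ?_⟩ <;> linarith
    · right
      refine ⟨fun h => ?_, ⟨?_, ?_⟩, fun h => ?_, ⟨?_, ?_⟩⟩ <;> linarith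
  fin_cases k <;>
    rcases h 0 with ⟨_, _, _, _⟩ | ⟨_, _, _, _⟩ <;>
    rcases h 1 with ⟨_, _, _, _⟩ | ⟨_, _, _, _⟩ <;>
    rcases h 2 with ⟨_, _, _, _⟩ | ⟨_, _, _, _⟩ <;>
    simp only [cubeSet, reflect, Set.mem_ofPred_eq, Fin.zero_eta, Fin.mk_one, Fin.reduceFinMk,
      Fin.reduceEq, if_true, if_false, unitInterval.coe_symm_eq, *, and_true, and_false, or_true,
      or_false, not_true, not_false_iff]

/-! ### The cube copula times independence -/

section

variable {d : ℕ} (hd : 3 ≤ d)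

/-- The set of points whose first three coordinates are in the support of the cube copula. -/
def cubeCylinder : Set (Fin d → unitInterval) :=
  (fun x k => x (Fin.castLE hd k)) ⁻¹' cubeSet

lemma measurableSet_cubeCylinder : MeasurableSet (cubeCylinder hd) :=
  measurableSet_cubeSet.preimage (measurable_pi_lambda _ fun _ => measurable_pi_apply _)

lemma reflect_mem_cubeCylinder (k : Fin 3) :
    ∀ᵐ x : Fin d → unitInterval,
      reflect (Fin.castLE hd k) x ∈ cubeCylinder hd ↔ x ∉ cubeCylinder hd := by
  have h' := ((ae_forall_ne (ι := Fin d) 0).and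
    (ae_forall_ne ⟨1 / 2, by norm_num, by norm_num⟩)).and (ae_forall_ne 1)
  filter_upwards [h'] with x hx
  have := reflect_mem_cubeSet (y := fun k => x (Fin.castLE hd k)) (fun i => by
    have h0 := hx.1.1 (Fin.castLE hd i)
    have h2 := hx.1.2 (Fin.castLE hd i)
    have h1 := hx.2 (Fin.castLE hd i)
    simp only [ne_eq, Subtype.ext_iff] at h0 h1 h2
    exact ⟨h0, h2, h1⟩) k
  have e : (fun i => reflect (Fin.castLE hd k) x (Fin.castLE hd i)) =
      reflect k fun i => x (Fin.castLE hd i) := by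
    ext i
    simp [reflect, (Fin.castLE_injective hd).eq_iff]
  rw [← e] at this
  exact this

/-- The reflection preserves volume and `S`, and exchanges the cylinder with its complement almost
everywhere, so the cylinder takes exactly half of `S`. -/
lemma volume_inter_cubeCylinder (k : Fin 3) {S : Set (Fin d → unitInterval)}
    (hS : MeasurableSet S) (h : reflect (Fin.castLE hd k) ⁻¹' S = S) :
    2 * volume (cubeCylinder hd ∩ S) = volume S := by
  have hE := measurableSet_cubeCylinder hd
  have e : volume (cubeCylinder hd ∩ S) = volume (S \ cubeCylinder hd) := by
    rw [← (measurePreserving_reflect (Fin.castLE hd k)).measure_preimage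
      (hE.inter hS).nullMeasurableSet]
    refine measure_congr ?_
    filter_upwards [reflect_mem_cubeCylinder hd k] with x hx
    have : reflect (Fin.castLE hd k) x ∈ S ↔ x ∈ S := Set.ext_iff.1 h x
    refine propext ?_
    change reflect (Fin.castLE hd k) x ∈ cubeCylinder hd ∧ reflect (Fin.castLE hd k) x ∈ S ↔
      x ∈ S ∧ x ∉ cubeCylinder hd
    rw [hx, this, and_comm]
  rw [two_mul]
  nth_rw 2 [e]
  rw [Set.inter_comm, measure_inter_add_sdiff S hE]

lemma volume_cubeCylinder : volume (cubeCylinder hd) = 2⁻¹ := by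
  have := volume_inter_cubeCylinder hd 0 MeasurableSet.univ rfl
  rw [Set.inter_univ, measure_univ, mul_comm] at this
  exact ENNReal.eq_inv_of_mul_eq_one_left this

lemma cond_cubeCylinder_apply (S : Set (Fin d → unitInterval)) :
    volume[|cubeCylinder hd] S = 2 * volume (cubeCylinder hd ∩ S) := by
  rw [cond_apply (measurableSet_cubeCylinder hd), volume_cubeCylinder, inv_inv]

/-- The conditional measure and the volume agree for functions not depending on one of the first
three coordinates. -/
lemma cond_cubeCylinder_map_eq (k : Fin 3) {β : Type*} [MeasurableSpace β]
    {g : (Fin d → unitInterval) → β} (hg : Measurable g)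
    (h : DependsOn g {Fin.castLE hd k}ᶜ) :
    (volume[|cubeCylinder hd]).map g = volume.map g := by
  ext S hS
  rw [Measure.map_apply hg hS, Measure.map_apply hg hS, cond_cubeCylinder_apply,
    volume_inter_cubeCylinder hd k (hg hS)]
  ext x
  have : g (reflect (Fin.castLE hd k) x) = g x := h fun i hi => if_neg hi
  simp [this]

/-- The product of the cube copula and the independence copula. -/
def cubeProd : Copula (Fin d) where
  measure := volume[|cubeCylinder hd]
  isProbabilityMeasure := cond_isProbabilityMeasure (by simp [volume_cubeCylinder])
  map_eval i := by
    -- A single coordinate always misses one of the first three.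
    obtain ⟨k, hk⟩ : ∃ k : Fin 3, i ≠ Fin.castLE hd k := by
      by_contra! h
      exact absurd (Fin.castLE_injective hd ((h 0).symm.trans (h 1))) (by decide)
    rw [cond_cubeCylinder_map_eq hd k (measurable_pi_apply i) fun x y h => h i (by simpa using hk)]
    exact (indep (Fin d)).map_eval i

lemma isCube_cubeProd : (cubeProd le_rfl).IsCube := rfl

lemma unifOn_cubeProd (k : Fin 3) {J : Finset (Fin d)} (hk : Fin.castLE hd k ∉ J) :
    (cubeProd hd).UnifOn J :=
  cond_cubeCylinder_map_eq hd k (Finset.measurable_restrict J)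
    ((dependsOn_restrict subset_rfl).mono fun _ hi h => hk (h ▸ hi))

lemma cubeProd_absolutelyContinuous : (cubeProd hd).measure ≪ volume :=
  cond_absolutelyContinuous

lemma cubeProd_mem_classC : cubeProd hd ∈ classC (Fin d) := fun _ _ _ _ hj =>
  (condDistrib_absolutelyContinuous (cubeProd_absolutelyContinuous hd) hj).mono
    fun _ => continuous_condDF

/-- Conditioning on an event determined by the coordinates in `S` does not disturb the independence
of `S` and `T` under Lebesgue measure. -/
lemma indepFun_cubeProd {S T : Finset (Fin d)} (h : Disjoint S T)
    (hS : ∀ k, Fin.castLE hd k ∈ S) :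
    IndepFun S.restrict T.restrict (cubeProd hd).measure := by
  obtain ⟨g, hg, e⟩ := exists_measurable_factor (J := S)
    (g := fun (x : Fin d → unitInterval) k => x (Fin.castLE hd k))
    (measurable_pi_lambda _ fun _ => measurable_pi_apply _)
    fun x y hxy => funext fun k => hxy _ (hS k)
  have hE : cubeCylinder hd = S.restrict ⁻¹' (g ⁻¹' cubeSet) := by
    rw [← Set.preimage_comp, ← e]; rfl
  have hv := indepFun_iff_measure_inter_preimage_eq_mul.1 (indepFun_restrict_volume h)
  refine indepFun_iff_measure_inter_preimage_eq_mul.2 fun A B hA hB => ?_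
  have hG := hg measurableSet_cubeSet
  have h1 := hv _ B (hG.inter hA) hB
  have h2 := hv _ B hG hB
  simp only [cubeProd, cond_cubeCylinder_apply]
  rw [← Set.inter_assoc, hE, ← Set.preimage_inter, h1, h2, ← hE, volume_cubeCylinder,
    ← mul_assoc 2 2⁻¹, ENNReal.mul_inv_cancel (by simp) (by simp), one_mul, mul_assoc]

lemma isProdIndep_cubeProd : IsProdIndep hd (cubeProd le_rfl) (cubeProd hd) := by
  intro u
  let S : Finset (Fin d) := Finset.univ.filter fun i => (i : ℕ) < 3
  let T : Finset (Fin d) := Finset.univ.filter fun i => 3 ≤ (i : ℕ)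
  let f : (Fin d → unitInterval) → Fin 3 → unitInterval := fun x k => x (Fin.castLE hd k)
  have hf : Measurable f := measurable_pi_lambda _ fun _ => measurable_pi_apply _
  have hS (k : Fin 3) : Fin.castLE hd k ∈ S := by simp [S]
  have hT : Fin.castLE hd 0 ∉ T := by simp [T]
  have hST : Disjoint S T := Finset.disjoint_left.2 fun i hi hi' => by simp [S, T] at hi hi'; omega
  have h1 : (cubeProd hd).measure (S.restrict ⁻¹' Set.Iic (S.restrict u)) =
      (cubeProd le_rfl).measure (Set.Iic (f u)) := by
    have e : S.restrict ⁻¹' Set.Iic (S.restrict u) = f ⁻¹' Set.Iic (f u) := by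
      ext x
      refine ⟨fun h k => h ⟨_, hS k⟩, fun h i => ?_⟩
      have hi : (i : ℕ) < 3 := (Finset.mem_filter.1 i.2).2
      exact h ⟨i, hi⟩
    have hc : cubeCylinder hd = f ⁻¹' cubeSet := rfl
    rw [e]
    simp only [cubeProd, cond_cubeCylinder_apply]
    rw [hc, ← Set.preimage_inter,
      ← Measure.map_apply hf (measurableSet_cubeSet.inter measurableSet_Iic),
      volume_map_precomp (Fin.castLE_injective hd)]
    rfl
  have h2 : (cubeProd hd).measure.real (T.restrict ⁻¹' Set.Iic (T.restrict u)) =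
      ∏ i ∈ T, (u i : ℝ) := by
    rw [← map_measureReal_apply (Finset.measurable_restrict T) measurableSet_Iic,
      unifOn_cubeProd hd 0 hT, volume_map_restrict, volume_real_pi_Iic]
    exact Finset.prod_coe_sort T fun i => (u i : ℝ)
  have h := indepFun_iff_measure_inter_preimage_eq_mul.1 (indepFun_cubeProd hd hST hS)
    (Set.Iic (S.restrict u)) (Set.Iic (T.restrict u)) measurableSet_Iic measurableSet_Iic
  have e : Set.Iic u = S.restrict ⁻¹' Set.Iic (S.restrict u) ∩
      T.restrict ⁻¹' Set.Iic (T.restrict u) := by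
    ext x
    refine ⟨fun h => ⟨fun i => h i, fun i => h i⟩, fun h i => ?_⟩
    by_cases hi : (i : ℕ) < 3
    · exact h.1 ⟨i, by simpa [S] using hi⟩
    · exact h.2 ⟨i, by simpa [T] using hi⟩
  change (cubeProd hd).measure.real (Set.Iic u) =
    (cubeProd le_rfl).measure.real (Set.Iic (f u)) * ∏ i ∈ T, (u i : ℝ)
  rw [e, measureReal_def, h, ENNReal.toReal_mul, h1, ← measureReal_def, ← measureReal_def, h2]

end

/-! ### Conditional copulas under independence -/

lemma vec_eta {α : Type*} (s : Fin 2 → α) : ![s 0, s 1] = s := by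
  ext k
  fin_cases k <;> rfl

lemma IndepFun.of_pair {ι : Type} {C : Copula ι} {L : Finset ι} {i j : ι}
    (h : IndepFun (fun x => (L.restrict x, x i)) (fun x => x j) C.measure) :
    IndepFun L.restrict (fun x => x j) C.measure :=
  h.comp measurable_fst measurable_id

/-- If the coordinate `j` is independent of the coordinates in `L` and `i`, the conditional
distribution of the coordinates `i, j` is a product. -/
lemma condDistrib_pair_of_indepFun {ι : Type} {C : Copula ι} {L : Finset ι} {i j : ι}
    (h : IndepFun (fun x => (L.restrict x, x i)) (fun x => x j) C.measure) :
    ∀ᵐ t ∂(C.marginal L).measure, ∀ u v : unitInterval,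
      (condDistrib (fun x : ι → unitInterval => (x i, x j)) L.restrict C.measure t).real
        (Set.Iic u ×ˢ Set.Iic v) = C.condDF L i t u * v := by
  have hL := Finset.measurable_restrict (X := fun _ : ι => unitInterval) L
  have hi : Measurable fun x : ι → unitInterval => x i := measurable_pi_apply i
  have hj : Measurable fun x : ι → unitInterval => x j := measurable_pi_apply j
  -- The product kernel is a version of the conditional law of the pair; this is checked on
  -- measurable boxes.
  have key : C.measure.map (fun x => (L.restrict x, x i, x j)) =
      C.measure.map L.restrict ⊗ₘ (condDistrib (fun x => x i) L.restrict C.measure ×ₖ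
        Kernel.const _ volume) := by
    refine Measure.ext_prod₃ fun {s t u} hs ht hu => ?_
    have h1 := congrArg (fun μ : Measure ((L → unitInterval) × unitInterval) => μ (s ×ˢ t)) (compProd_map_condDistrib (X := L.restrict)
      (μ := C.measure) hi.aemeasurable)
    simp only [Measure.compProd_apply_prod hs ht, Measure.map_apply (hL.prodMk hi) (hs.prod ht)]
      at h1
    have h2 := indepFun_iff_measure_inter_preimage_eq_mul.1 h _ u (hs.prod ht) hu
    rw [← h1, ← Measure.map_apply hj hu, C.map_eval j] at h2
    rw [Measure.compProd_apply_prod hs (ht.prod hu),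
      Measure.map_apply (hL.prodMk (hi.prodMk hj)) (hs.prod (ht.prod hu))]
    simp only [Kernel.prod_apply, Measure.prod_prod, Kernel.const_apply]
    rw [lintegral_mul_const _ (Kernel.measurable_coe _ ht), ← h2]
    congr 1
    ext x
    simp [and_assoc]
  filter_upwards [condDistrib_ae_eq_of_measure_eq_compProd L.restrict
    (hi.prodMk hj).aemeasurable key] with t ht u v
  rw [ht, Kernel.prod_apply, measureReal_def, Measure.prod_prod, ENNReal.toReal_mul,
    Kernel.const_apply, unitInterval.volume_Iic, ENNReal.toReal_ofReal v.2.1]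
  rfl

section

variable {ι : Type} [Fintype ι]

lemma indep_fin_two (s : Fin 2 → unitInterval) :
    (indep (Fin 2)).measure.real (Set.Iic s) = s 0 * s 1 := by
  rw [indep_apply, Fin.prod_univ_two]

lemma isCondCopula_indep {C : Copula ι} {L : Finset ι} {i j : ι}
    (h : IndepFun (fun x => (L.restrict x, x i)) (fun x => x j) C.measure) :
    C.IsCondCopula i j L fun _ => indep (Fin 2) := by
  refine ⟨fun _ => measurable_const, ?_⟩
  filter_upwards [condDistrib_pair_of_indepFun h, condDF_of_indepFun (IndepFun.of_pair h)]
    with t h1 h2 u v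
  rw [h1, h2, indep_fin_two, Matrix.cons_val_zero, Matrix.cons_val_one, Matrix.cons_val_fin_one]

/-- The Sklar identity gives the product formula only on the range of the conditional distribution
functions; absolute continuity makes that of `i` surjective, and that of `j` is the identity. -/
lemma IsCondCopula.ae_eq_indep {C : Copula ι} {L : Finset ι} {i j : ι}
    (h : IndepFun (fun x => (L.restrict x, x i)) (fun x => x j) C.measure)
    (hC : C.measure ≪ volume) (hi : i ∉ L) {A : (L → unitInterval) → Copula (Fin 2)}
    (hA : C.IsCondCopula i j L A) :
    ∀ᵐ t ∂(C.marginal L).measure, ∀ s, A t s = s 0 * s 1 := by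
  filter_upwards [condDistrib_pair_of_indepFun h, condDF_of_indepFun (IndepFun.of_pair h), hA.2,
    condDistrib_absolutelyContinuous hC hi] with t h1 h2 h3 h4 s
  obtain ⟨u, hu⟩ := condDF_surjective h4 (s 0)
  have h5 := h3 u (s 1)
  rw [h1, h2, hu, vec_eta] at h5
  exact h5.symm

/-- Almost every conditional law of the pair already has uniform margins, hence is itself the
conditional copula. -/
lemma exists_isCondCopula {C : Copula ι} {L : Finset ι} {i j : ι}
    (hi : IndepFun L.restrict (fun x => x i) C.measure)
    (hj : IndepFun L.restrict (fun x => x j) C.measure) :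
    ∃ A, C.IsCondCopula i j L A := by
  classical
  have hmi : Measurable fun x : ι → unitInterval => x i := measurable_pi_apply i
  have hmj : Measurable fun x : ι → unitInterval => x j := measurable_pi_apply j
  let κ := condDistrib (fun x : ι → unitInterval => (x i, x j)) L.restrict C.measure
  have hG : ∀ᵐ t ∂(C.marginal L).measure,
      (κ t).map Prod.fst = volume ∧ (κ t).map Prod.snd = volume := by
    filter_upwards [condDistrib_of_indepFun hi, condDistrib_of_indepFun hj,
      condDistrib_comp (μ := C.measure) L.restrict (hmi.prodMk hmj).aemeasurable measurable_fst,
      condDistrib_comp (μ := C.measure) L.restrict (hmi.prodMk hmj).aemeasurable measurable_snd]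
      with t h1 h2 h3 h4
    rw [Kernel.map_apply _ measurable_fst] at h3
    rw [Kernel.map_apply _ measurable_snd] at h4
    exact ⟨h3.symm.trans h1, h4.symm.trans h2⟩
  -- A measurable set of good `t` keeps the family measurable when Π is substituted outside it.
  obtain ⟨G, hGae, hGm, hG⟩ := hG.exists_measurable_mem
  have hp : Measurable fun p : unitInterval × unitInterval => ![p.1, p.2] := by
    refine measurable_pi_lambda _ fun k => ?_
    fin_cases k
    · exact measurable_fst
    · exact measurable_snd
  let A (t : L → unitInterval) : Copula (Fin 2) :=
    if h : t ∈ G then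
      { measure := (κ t).map fun p => ![p.1, p.2]
        isProbabilityMeasure := Measure.isProbabilityMeasure_map hp.aemeasurable
        map_eval k := by
          rw [Measure.map_map (measurable_pi_apply k) hp]
          fin_cases k
          · exact (hG t h).1
          · exact (hG t h).2 }
    else indep (Fin 2)
  have hAt (t) (h : t ∈ G) (s : Fin 2 → unitInterval) :
      (A t).measure.real (Set.Iic s) = (κ t).real (Set.Iic (s 0) ×ˢ Set.Iic (s 1)) := by
    simp only [A, h, dif_pos]
    rw [map_measureReal_apply hp measurableSet_Iic]
    congr 1
    ext p
    simp [Pi.le_def, Fin.forall_fin_two, Prod.le_def]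
  refine ⟨A, fun s => ?_, ?_⟩
  · have e : (fun t => A t s) = fun t => if t ∈ G then
        (κ t).real (Set.Iic (s 0) ×ˢ Set.Iic (s 1)) else indep (Fin 2) s := by
      ext t
      split_ifs with h
      · exact hAt t h s
      · simp only [A, h, dif_neg, not_false_iff]
    rw [e]
    exact Measurable.ite hGm
      (Kernel.measurable_coe κ (measurableSet_Iic.prod measurableSet_Iic)).ennreal_toReal
      measurable_const
  · filter_upwards [hGae, condDF_of_indepFun hi, condDF_of_indepFun hj] with t h1 h2 h3 u v
    rw [h2, h3, hAt t h1]
    rfl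

/-- With uniform conditional margins the conditional copula equals the conditional law, and
averaging conditional laws gives the joint law of `i` and `j`. -/
lemma IsCondCopula.integral_eq {C : Copula ι} {L : Finset ι} {i j : ι}
    (hi : IndepFun L.restrict (fun x => x i) C.measure)
    (hj : IndepFun L.restrict (fun x => x j) C.measure)
    (hij : IndepFun (fun x => x i) (fun x => x j) C.measure)
    {A : (L → unitInterval) → Copula (Fin 2)} (hA : C.IsCondCopula i j L A)
    (s : Fin 2 → unitInterval) :
    ∫ w, A w s ∂(C.marginal L).measure = s 0 * s 1 := by
  have hmi : Measurable fun x : ι → unitInterval => x i := measurable_pi_apply i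
  have hmj : Measurable fun x : ι → unitInterval => x j := measurable_pi_apply j
  have hB : MeasurableSet (Set.Iic (s 0) ×ˢ Set.Iic (s 1)) :=
    measurableSet_Iic.prod measurableSet_Iic
  let κ := condDistrib (fun x : ι → unitInterval => (x i, x j)) L.restrict C.measure
  have e : ∀ᵐ w ∂(C.marginal L).measure,
      A w s = (κ w (Set.Iic (s 0) ×ˢ Set.Iic (s 1))).toReal := by
    filter_upwards [hA.2, condDF_of_indepFun hi, condDF_of_indepFun hj] with t h1 h2 h3
    rw [← measureReal_def, h1, h2, h3, vec_eta]
  rw [integral_congr_ae e, integral_toReal (Kernel.measurable_coe κ hB).aemeasurable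
    (ae_of_all _ fun _ => measure_lt_top _ _), ← Measure.bind_apply hB κ.aemeasurable]
  have := condDistrib_comp_map (X := L.restrict) (μ := C.measure)
    (Finset.measurable_restrict L).aemeasurable (hmi.prodMk hmj).aemeasurable
  change ((κ ∘ₘ C.measure.map L.restrict) _).toReal = _
  rw [this, (indepFun_iff_map_prod_eq_prod_map_map hmi.aemeasurable hmj.aemeasurable).1 hij,
    C.map_eval, C.map_eval, Measure.prod_prod, ENNReal.toReal_mul, unitInterval.volume_Iic,
    unitInterval.volume_Iic, ENNReal.toReal_ofReal (s 0).2.1, ENNReal.toReal_ofReal (s 1).2.1]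

end

/-! ### The D-vine construction when all partial copulas are Π -/

lemma setIntegral_condDF {ι : Type} [Fintype ι] [DecidableEq ι] {D : Copula ι} {L : Finset ι}
    {i j : ι} (hi : D.UnifOn (insert i L)) (hiL : i ∉ L) (hj : D.UnifOn (insert j L)) (hjL : j ∉ L)
    {P : Copula (Fin 2)} (hP : ∀ s, P.measure.real (Set.Iic s) = s 0 * s 1)
    (u : ι → unitInterval) :
    ∫ t in Set.Iic (L.restrict u),
      P.measure.real (Set.Iic ![D.condDF L i t (u i), D.condDF L j t (u j)])
        ∂(D.marginal L).measure = u i * (u j * ∏ k ∈ L, (u k : ℝ)) := by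
  -- The conditional distribution functions are the identity, so the integrand is almost everywhere
  -- constant.
  have h : ∀ᵐ t ∂(D.marginal L).measure,
      P.measure.real (Set.Iic ![D.condDF L i t (u i), D.condDF L j t (u j)]) =
        (u i : ℝ) * u j := by
    filter_upwards [condDF_of_indepFun (hi.indepFun_eval hiL),
      condDF_of_indepFun (hj.indepFun_eval hjL)] with t h1 h2
    rw [hP, h1, h2, Matrix.cons_val_zero, Matrix.cons_val_one, Matrix.cons_val_fin_one]
  rw [integral_congr_ae (ae_restrict_of_ae h), setIntegral_const,
    (hi.mono (Finset.subset_insert _ _)).marginal_measure, volume_real_pi_Iic, smul_eq_mul,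
    ← Finset.prod_coe_sort L fun k => (u k : ℝ)]
  simp only [Finset.restrict]
  ring

section

variable {d : ℕ}

lemma prod_Icc_eq {i j : Fin d} (hij : i < j) (f : Fin d → ℝ) :
    ∏ k ∈ Finset.Icc i j, f k = f i * (f j * ∏ k ∈ Finset.Ioo i j, f k) := by
  rw [← Finset.Ioc_insert_left hij.le, Finset.prod_insert (by simp),
    ← Finset.Ioo_insert_right hij, Finset.prod_insert (by simp)]

lemma unifOn_Icc_of_Iic {D : Copula (Fin d)} {i j : Fin d}
    (h : ∀ u : Fin d → unitInterval,
      (D.marginal (Finset.Icc i j)).measure.real (Set.Iic ((Finset.Icc i j).restrict u)) =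
        ∏ k ∈ Finset.Icc i j, (u k : ℝ)) : D.UnifOn (Finset.Icc i j) := by
  rw [unifOn_iff_marginal_eq]
  refine eq_volume_of_Iic fun v => ?_
  let u : Fin d → unitInterval := fun k => if hk : k ∈ Finset.Icc i j then v ⟨k, hk⟩ else 0
  have hu (k) (hk : k ∈ Finset.Icc i j) : u k = v ⟨k, hk⟩ := dif_pos hk
  have e : (Finset.Icc i j).restrict u = v := funext fun k => hu k k.2
  have h := h u
  rw [e, ← Finset.prod_coe_sort (Finset.Icc i j) fun k => (u k : ℝ)] at h
  rw [← ofReal_measureReal, h, ENNReal.ofReal_prod_of_nonneg fun k _ => (u k.1).2.1]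
  exact Finset.prod_congr rfl fun k _ => by rw [hu k k.2]

/-- If every family of conditional copulas of `C` integrates to the independence copula and the
marginals of neighbours are independent, then the D-vine construction yields independence. -/
lemma IsPartialDVine.eq_indep {C D : Copula (Fin d)} (hd : 2 ≤ d)
    (h1 : ∀ i j : Fin d, (i : ℕ) + 1 = j → C.UnifOn {i, j})
    (h2 : ∀ i j : Fin d, (i : ℕ) + 2 ≤ j → ∀ A, C.IsCondCopula i j (Finset.Ioo i j) A →
      ∀ s, ∫ w, (A w).measure.real (Set.Iic s) = s 0 * s 1)
    (hD : IsPartialDVine C D) : D = indep (Fin d) := by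
  -- Here `n` bounds the number of coordinates strictly between `i` and `j`.
  have key : ∀ n : ℕ, ∀ i j : Fin d, (i : ℕ) + 1 ≤ j → (j : ℕ) ≤ i + 1 + n →
      D.UnifOn (Finset.Icc i j) := by
    intro n
    induction n with
    | zero =>
      intro i j hij hn
      have hj : (i : ℕ) + 1 = j := by omega
      have e : Finset.Icc i j = {i, j} := by
        ext k
        simp only [Finset.mem_Icc, Finset.mem_insert, Finset.mem_singleton, Fin.le_def, Fin.ext_iff]
        omega
      rw [e, unifOn_iff_marginal_eq, hD.1 i j hj, ← unifOn_iff_marginal_eq]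
      exact h1 i j hj
    | succ n ih =>
      intro i j hij hn
      rcases Nat.lt_or_ge (j : ℕ) (i + 2) with hj | hj
      · exact ih i j hij (by omega)
      obtain ⟨A, P, hA, hP, hu⟩ := hD.2 i j hj
      -- Dropping one endpoint leaves a shorter interval, covered by the induction hypothesis.
      have hi : D.UnifOn (insert i (Finset.Ioo i j)) :=
        (ih i ⟨j - 1, by omega⟩ (by simp; omega) (by simp; omega)).mono fun k => by
          simp only [Finset.mem_insert, Finset.mem_Ioo, Finset.mem_Icc, Fin.le_def, Fin.lt_def,
            Fin.ext_iff]
          omega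
      have hj : D.UnifOn (insert j (Finset.Ioo i j)) :=
        (ih ⟨i + 1, by omega⟩ j (by simp; omega) (by simp; omega)).mono fun k => by
          simp only [Finset.mem_insert, Finset.mem_Ioo, Finset.mem_Icc, Fin.le_def, Fin.lt_def,
            Fin.ext_iff]
          omega
      have hP' (s : Fin 2 → unitInterval) : P.measure.real (Set.Iic s) = s 0 * s 1 := by
        refine (hP s).trans ?_
        rw [(hi.mono (Finset.subset_insert _ _)).marginal_measure]
        exact h2 i j (by omega) A hA s
      refine unifOn_Icc_of_Iic fun u => (hu u).trans ?_
      rw [prod_Icc_eq (Fin.lt_def.2 (by omega))]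
      exact setIntegral_condDF hi (by simp) hj (by simp) hP' u
  refine UnifOn.eq_indep ?_
  have := key d ⟨0, by omega⟩ ⟨d - 1, by omega⟩ (by simp; omega) (by simp; omega)
  refine this.mono fun k _ => ?_
  simp only [Finset.mem_Icc, Fin.le_def]
  omega

lemma isPartialDVine_indep {C : Copula (Fin d)}
    (h1 : ∀ i j : Fin d, (i : ℕ) + 1 = j → C.UnifOn {i, j})
    (h2 : ∀ i j : Fin d, (i : ℕ) + 2 ≤ j → ∀ A, C.IsCondCopula i j (Finset.Ioo i j) A →
      ∀ s, ∫ w, (A w).measure.real (Set.Iic s) = s 0 * s 1)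
    (h3 : ∀ i j : Fin d, (i : ℕ) + 2 ≤ j → ∃ A, C.IsCondCopula i j (Finset.Ioo i j) A) :
    IsPartialDVine C (indep (Fin d)) := by
  refine ⟨fun i j hij => measure_injective ?_, fun i j hij => ?_⟩
  · rw [unifOn_iff_marginal_eq.1 (unifOn_indep _), unifOn_iff_marginal_eq.1 (h1 i j hij)]
  · obtain ⟨A, hA⟩ := h3 i j hij
    refine ⟨A, indep (Fin 2), hA, fun s => ?_, fun u => ?_⟩
    · refine (indep_fin_two s).trans (Eq.symm ?_)
      rw [unifOn_iff_marginal_eq.1 (unifOn_indep _)]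
      exact h2 i j hij A hA s
    · refine Eq.trans ?_ (setIntegral_condDF (unifOn_indep _) (by simp) (unifOn_indep _) (by simp)
        indep_fin_two u).symm
      rw [← prod_Icc_eq (Fin.lt_def.2 (by omega)) fun k => (u k : ℝ),
        unifOn_iff_marginal_eq.1 (unifOn_indep _)]
      refine (volume_real_pi_Iic _).trans ?_
      exact Finset.prod_coe_sort (Finset.Icc i j) fun k => (u k : ℝ)

lemma partialDVine_eq {C D : Copula (Fin d)} (h : ∃! D, IsPartialDVine C D)
    (hD : IsPartialDVine C D) : partialDVine C = D := by
  rw [partialDVine, dif_pos h]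
  exact h.unique h.choose_spec.1 hD

end

/-! ### The construction applied to the cube example -/

section

variable {d : ℕ} (hd : 3 ≤ d)

lemma unifOn_cubeProd_of_succ {i j : Fin d} (hij : (i : ℕ) + 1 = j) :
    (cubeProd hd).UnifOn {i, j} := by
  rcases Nat.eq_zero_or_pos (i : ℕ) with hi | hi
  · refine unifOn_cubeProd hd 2 ?_
    simp [Fin.ext_iff]
    omega
  · refine unifOn_cubeProd hd 0 ?_
    simp [Fin.ext_iff]
    omega

lemma cubeProd_unifOn_Ioo (i j : Fin d) : (cubeProd hd).UnifOn (Finset.Ioo i j) :=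
  unifOn_cubeProd hd 0 fun h => absurd (Fin.lt_def.1 (Finset.mem_Ioo.1 h).1) (by simp)

/-- For `j ≥ 3`, the coordinate `j` is independent of all other coordinates. -/
lemma indepFun_cubeProd_Ioo {i j : Fin d} (hij : i < j) (hj : 3 ≤ (j : ℕ)) :
    IndepFun (fun x => ((Finset.Ioo i j).restrict x, x i)) (fun x => x j)
      (cubeProd hd).measure := by
  have h : IndepFun (Finset.univ.erase j).restrict (fun x => x j) (cubeProd hd).measure :=
    indepFun_restrict_eval (indepFun_cubeProd hd (by simp) fun k => by simp [Fin.ext_iff]; omega)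
  refine h.comp (φ := fun y : ↥(Finset.univ.erase j) → unitInterval =>
    ((fun k : Finset.Ioo i j => y ⟨k, by simpa using (Finset.mem_Ioo.1 k.2).2.ne⟩),
      y ⟨i, by simpa using hij.ne⟩)) (ψ := id) ?_ measurable_id
  exact (measurable_pi_lambda _ fun _ => measurable_pi_apply _).prodMk (measurable_pi_apply _)

/-- The only such pair is (0,2), with 1 between. Each claim involves just two of these coordinates,
so the third may be reflected. -/
lemma indepFun_cubeProd_of_lt {i j : Fin d} (hij : (i : ℕ) + 2 ≤ j) (hj : (j : ℕ) < 3) :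
    IndepFun (Finset.Ioo i j).restrict (fun x => x i) (cubeProd hd).measure ∧
    IndepFun (Finset.Ioo i j).restrict (fun x => x j) (cubeProd hd).measure ∧
    IndepFun (fun x => x i) (fun x => x j) (cubeProd hd).measure := by
  have hi0 : (i : ℕ) = 0 := by omega
  have hj2 : (j : ℕ) = 2 := by omega
  refine ⟨UnifOn.indepFun_eval (unifOn_cubeProd hd 2 ?_) (by simp),
    UnifOn.indepFun_eval (unifOn_cubeProd hd 0 ?_) (by simp), ?_⟩
  · simp [Fin.lt_def, hi0, hj2]
  · simp [Fin.lt_def, hi0, hj2]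
  · have h : IndepFun ({i} : Finset (Fin d)).restrict (fun x => x j) (cubeProd hd).measure :=
      UnifOn.indepFun_eval (unifOn_cubeProd hd 1 (by simp [Fin.ext_iff, hi0, hj2]))
        (by simp [Fin.ext_iff, hi0, hj2])
    exact h.comp (φ := fun y : ({i} : Finset (Fin d)) → unitInterval => y ⟨i, by simp⟩)
      (measurable_pi_apply _) measurable_id

lemma integral_condCopula_cubeProd {i j : Fin d} (hij : (i : ℕ) + 2 ≤ j)
    {A : (Finset.Ioo i j → unitInterval) → Copula (Fin 2)}
    (hA : (cubeProd hd).IsCondCopula i j (Finset.Ioo i j) A) (s : Fin 2 → unitInterval) :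
    ∫ w, (A w).measure.real (Set.Iic s) = s 0 * s 1 := by
  rw [← (cubeProd_unifOn_Ioo hd i j).marginal_measure]
  rcases Nat.lt_or_ge (j : ℕ) 3 with hj | hj
  · obtain ⟨h1, h2, h3⟩ := indepFun_cubeProd_of_lt hd hij hj
    exact hA.integral_eq h1 h2 h3 s
  · have h := hA.ae_eq_indep (indepFun_cubeProd_Ioo hd (Fin.lt_def.2 (by omega)) hj)
      (cubeProd_absolutelyContinuous hd) (by simp)
    rw [integral_congr_ae (h.mono fun t ht => ht s)]
    simp

lemma exists_condCopula_cubeProd {i j : Fin d} (hij : (i : ℕ) + 2 ≤ j) :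
    ∃ A, (cubeProd hd).IsCondCopula i j (Finset.Ioo i j) A := by
  rcases Nat.lt_or_ge (j : ℕ) 3 with hj | hj
  · obtain ⟨h1, h2, -⟩ := indepFun_cubeProd_of_lt hd hij hj
    exact exists_isCondCopula h1 h2
  · exact ⟨_, isCondCopula_indep (indepFun_cubeProd_Ioo hd (Fin.lt_def.2 (by omega)) hj)⟩

lemma isPartialDVine_cubeProd : IsPartialDVine (cubeProd hd) (indep (Fin d)) :=
  isPartialDVine_indep (fun _ _ => unifOn_cubeProd_of_succ hd)
    (fun _ _ hij _ => integral_condCopula_cubeProd hd hij)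
    (fun _ _ => exists_condCopula_cubeProd hd)

lemma existsUnique_isPartialDVine_cubeProd : ∃! D, IsPartialDVine (cubeProd hd) D :=
  ⟨_, isPartialDVine_cubeProd hd, fun _ => IsPartialDVine.eq_indep (by omega)
    (fun _ _ => unifOn_cubeProd_of_succ hd)
    (fun _ _ hij _ => integral_condCopula_cubeProd hd hij)⟩

lemma partialDVine_cubeProd : partialDVine (cubeProd hd) = indep (Fin d) :=
  partialDVine_eq (existsUnique_isPartialDVine_cubeProd hd) (isPartialDVine_cubeProd hd)

end

/-! ### The uniform distance -/

lemma abs_sub_le_one {ι : Type} (C₁ C₂ : Copula ι) (u : ι → unitInterval) :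
    |C₁.measure.real (Set.Iic u) - C₂.measure.real (Set.Iic u)| ≤ 1 :=
  abs_sub_le_of_nonneg_of_le measureReal_nonneg measureReal_le_one measureReal_nonneg
    measureReal_le_one

lemma dInf_le_one {ι : Type} (C₁ C₂ : Copula ι) : dInf C₁ C₂ ≤ 1 :=
  ciSup_le fun u => abs_sub_le_one C₁ C₂ u

lemma le_dInf {ι : Type} (C₁ C₂ : Copula ι) (u : ι → unitInterval) :
    |C₁.measure.real (Set.Iic u) - C₂.measure.real (Set.Iic u)| ≤ dInf C₁ C₂ :=
  le_ciSup (f := fun u => |C₁ u - C₂ u|)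
    ⟨1, Set.forall_mem_range.2 fun u => abs_sub_le_one C₁ C₂ u⟩ u

lemma one_eighth_le_dInf_cubeProd {d : ℕ} (hd : 3 ≤ d) :
    1 / 8 ≤ dInf (cubeProd hd) (indep (Fin d)) := by
  let c : unitInterval := ⟨1 / 2, by norm_num, by norm_num⟩
  let u : Fin d → unitInterval := fun i => if (i : ℕ) < 3 then c else 1
  have hprod : ∏ i, (u i : ℝ) = 1 / 8 := by
    have e (i : Fin d) : (u i : ℝ) = if (i : ℕ) < 3 then 1 / 2 else 1 := by
      simp only [u, c]
      split_ifs <;> rfl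
    rw [Finset.prod_congr rfl fun i _ => e i, Finset.prod_ite, Finset.prod_const,
      Finset.prod_const_one, Fin.card_filter_val_lt, min_eq_right hd]
    norm_num
  have hcube : (cubeProd hd).measure.real (Set.Iic u) = 1 / 4 := by
    -- Up to a null set the box lies over the lowest of the four cubes, so conditioning doubles its
    -- volume 1/8.
    have e : volume (cubeCylinder hd ∩ Set.Iic u) = volume (Set.Iic u) := by
      refine measure_congr ?_
      filter_upwards [ae_forall_ne 0, ae_forall_ne c] with x h0 hc
      refine propext ⟨fun h => h.2, fun h => ⟨?_, h⟩⟩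
      have hx (k : Fin 3) : (x (Fin.castLE hd k) : ℝ) ∈ Set.Ioo 0 (1 / 2) := by
        have h1 : x (Fin.castLE hd k) ≤ c := by simpa [u] using h (Fin.castLE hd k)
        exact ⟨lt_of_le_of_ne (x _).2.1 fun h => h0 (Fin.castLE hd k) (Subtype.ext h.symm),
          lt_of_le_of_ne h1 fun h => hc (Fin.castLE hd k) (Subtype.ext h)⟩
      exact Or.inl ⟨hx 0, hx 1, hx 2⟩
    have h := cond_cubeCylinder_apply hd (Set.Iic u)
    rw [e] at h
    change (volume[|cubeCylinder hd]).real _ = _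
    rw [measureReal_def, h, ENNReal.toReal_mul, ← measureReal_def, volume_real_pi_Iic, hprod]
    norm_num
  refine le_trans ?_ (le_dInf _ _ u)
  rw [hcube, indep_apply, hprod]
  norm_num [abs_of_pos]

end Copula

end


theorem theorem7p5 (d : ℕ) (hd : 3 ≤ d) :
    (∃ Q : Copula (Fin 3), Q.IsCube ∧
      ∃ C : Copula (Fin d), Copula.IsProdIndep hd Q C ∧
        C ∈ Copula.classC (Fin d) ∧
        (∃! D : Copula (Fin d), Copula.IsPartialDVine C D) ∧
        Copula.partialDVine C = Copula.indep (Fin d) ∧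
        1 / 8 ≤ Copula.dInf C (Copula.partialDVine C)) ∧
    BddAbove (Set.range fun C : Copula.classC (Fin d) =>
      Copula.dInf (C : Copula (Fin d)) (Copula.partialDVine (C : Copula (Fin d)))) ∧
    1 / 8 ≤ ⨆ C : Copula.classC (Fin d),
      Copula.dInf (C : Copula (Fin d)) (Copula.partialDVine (C : Copula (Fin d))) := by
  have h : 1 / 8 ≤ Copula.dInf (Copula.cubeProd hd) (Copula.partialDVine (Copula.cubeProd hd)) := by
    rw [Copula.partialDVine_cubeProd]
    exact Copula.one_eighth_le_dInf_cubeProd hd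
  have hb : BddAbove (Set.range fun C : Copula.classC (Fin d) =>
      Copula.dInf (C : Copula (Fin d)) (Copula.partialDVine (C : Copula (Fin d)))) :=
    ⟨1, Set.forall_mem_range.2 fun _ => Copula.dInf_le_one _ _⟩
  exact ⟨⟨Copula.cubeProd le_rfl, Copula.isCube_cubeProd, Copula.cubeProd hd,
    Copula.isProdIndep_cubeProd hd, Copula.cubeProd_mem_classC hd,
    Copula.existsUnique_isPartialDVine_cubeProd hd, Copula.partialDVine_cubeProd hd, h⟩, hb,
    h.trans (le_ciSup hb ⟨Copula.cubeProd hd, Copula.cubeProd_mem_classC hd⟩)⟩
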